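/- Let $\Delta$ be an irreducible reduced crystallographic root system spanning a finite-dimensional vector space $V$ over a field $K$ of characteristic $0$ (for instance the root system of a simple Lie algebra $\mathfrak g$ with respect to a Cartan subalgebra), let $\Pi\subset\Delta^+$ be a system of simple roots and the corresponding set of positive roots, let $\theta$ be the highest root, and let $(\ ,\ )$ be a symmetric bilinear form on $V$, invariant under the Weyl group, with $(\alpha,\alpha)\neq 0$ for all $\alpha\in\Delta$. Extend it to $\widehat V=V\oplus K\delta\oplus K\lambda$ by $(\delta,V)=(\lambda,V)=(\delta,\delta)=(\lambda,\lambda)=0$, $(\delta,\lambda)=1$. Let $\widehat\Delta=\{\beta+k\delta\mid \beta\in\Delta,\ k\in\mathbb Z\}$ be the set of affine real roots, $\widehat\Delta^+=\Delta^+\cup\{\beta+k\delta\mid\beta\in\Delta,\ k\ge 1\}$ the set of positive ones, $\widehat\Pi=\Pi\cup\{\delta-\theta\}$ the set of affine simple roots, and let $\widehat W\subset GL(\widehat V)$ be the affine Weyl group, generated by the reflections in the affine real roots. An element of $\widehat\Delta$ is called negative, written $<0$, if it lies in $-\widehat\Delta^+$. An element $w\in\widehat W$ is called admissible if (a) $w(\alpha)\in\widehat\Delta^+$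 for all $\alpha\in\Pi$, and (b) whenever $\alpha\in\widehat\Pi$ and $w^{-1}(\alpha)<0$, one has $w^{-1}(\alpha)=\gamma-\delta$ for some $\gamma\in\Delta^+$. For admissible $w$ put $I_w=\{\gamma\in\Delta^+\mid \delta-\gamma\in\widehat\Delta^+ \text{ and } w(\delta-\gamma)<0\}$. An element $\gamma\in I_w$ is called a generator of $I_w$ if $\gamma-\alpha\notin I_w$ for every $\alpha\in\Delta^+$. Let $w\in\widehat W$ be admissible. Then: 1. $I_w$ is an ad-nilpotent ideal, that is, $I_w\subset\Delta^+$, and if $\gamma\in I_w$, $\nu\in\Delta^+$ and $\gamma+\nu\in\Delta$, then $\gamma+\nu\in I_w$. 2. For every $\gamma\in I_w$: $\gamma$ is a generator of $I_w$ if and only if $w(\delta-\gamma)\in-\widehat\Pi$. 3. The number of generators of $I_w$ equals the number of $\alpha\in\widehat\Pi$ with $w^{-1}(\alpha)<0$. -/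

import Mathlib

namespace AdNilpotent

open scoped Pointwise

noncomputable section

section Finite

variable {ι K V N : Type*} [Field K] [CharZero K] [AddCommGroup V] [Module K V]
  [AddCommGroup N] [Module K N] {P : RootPairing ι K V N}

/-- The set `Δ⁺` of positive roots, as vectors of `V`. -/
def positiveRoots (b : P.Base) : Set V :=
  {x | ∃ i, b.IsPos i ∧ P.root i = x}

/-- A combinatorial ad-nilpotent ideal: a subset `I` of `Δ⁺` such that `γ + ν ∈ I` whenever
`γ ∈ I`, `ν ∈ Δ⁺` and `γ + ν` is a root. -/
structure IsIdeal (b : P.Base) (I : Set V) : Prop where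
  subset : I ⊆ positiveRoots b
  add_mem : ∀ γ ∈ I, ∀ ν ∈ positiveRoots b, γ + ν ∈ Set.range P.root → γ + ν ∈ I

/-- `γ` is a generator of `I`. -/
def IsGenerator (b : P.Base) (I : Set V) (γ : V) : Prop :=
  γ ∈ I ∧ ∀ α ∈ positiveRoots b, γ - α ∉ I

/-- `θ` is the highest root: `θ` is a root and `θ - β ∈ Q⁺` for every root `β`, where `Q⁺` is the
set of combinations of the simple roots with natural number coefficients. -/
def IsHighestRoot (b : P.Base) (θ : V) : Prop :=
  θ ∈ Set.range P.root ∧ ∀ i, θ - P.root i ∈ AddSubmonoid.closure (P.root '' b.support)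

end Finite

section Affine

/-- The space `V ⊕ K δ ⊕ K λ`. -/
abbrev AffineSpan (K V : Type*) : Type _ := V × K × K

/-- The inclusion of `V` in `V ⊕ K δ ⊕ K λ`. -/
def incl (K : Type*) {V : Type*} [Field K] (x : V) : AffineSpan K V := (x, 0, 0)

/-- The vector `δ`. -/
def delta (K V : Type*) [Field K] [AddCommGroup V] : AffineSpan K V := (0, 1, 0)

variable {ι K V N : Type*} [Field K] [CharZero K] [AddCommGroup V] [Module K V]
  [AddCommGroup N] [Module K N] {P : RootPairing ι K V N}

/-- The affine real root `β + k δ`, where `β` is the root with index `i`. -/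
def affineRoot (P : RootPairing ι K V N) (i : ι) (k : ℤ) : AffineSpan K V :=
  incl K (P.root i) + (k : K) • delta K V

/-- The set of affine real roots. -/
def affineRoots (P : RootPairing ι K V N) : Set (AffineSpan K V) :=
  {x | ∃ (i : ι) (k : ℤ), affineRoot P i k = x}

/-- The set of positive affine roots: the positive roots together with all `β + k δ`, `k ≥ 1`. -/
def positiveAffineRoots (b : P.Base) : Set (AffineSpan K V) :=
  {x | ∃ i, b.IsPos i ∧ affineRoot P i 0 = x} ∪ {x | ∃ (i : ι) (k : ℤ), 1 ≤ k ∧ affineRoot P i k = x}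

/-- The set of affine simple roots: the simple roots together with `δ - θ`, `θ` the highest root. -/
def affineSimpleRoots (b : P.Base) : Set (AffineSpan K V) :=
  {x | ∃ i ∈ b.support, affineRoot P i 0 = x} ∪
    {x | ∃ θ, IsHighestRoot b θ ∧ delta K V - incl K θ = x}

/-- The extension of an invariant form `( , )` on `V` to `V ⊕ K δ ⊕ K λ` for which
`(δ, V) = (λ, V) = (δ, δ) = (λ, λ) = 0` and `(δ, λ) = 1`. -/
def affineForm (B : P.InvariantForm) : LinearMap.BilinForm K (AffineSpan K V) :=
  LinearMap.mk₂ K (fun x y => B.form x.1 y.1 + x.2.1 * y.2.2 + x.2.2 * y.2.1)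
    (by intro x x' y; simp; ring) (by intro c x y; simp; ring)
    (by intro x y y'; simp; ring) (by intro c x y; simp; ring)

theorem affineForm_apply (B : P.InvariantForm) (x y : AffineSpan K V) :
    affineForm B x y = B.form x.1 y.1 + x.2.1 * y.2.2 + x.2.2 * y.2.1 := rfl

theorem affineForm_affineRoot_self (B : P.InvariantForm) (i : ι) (k : ℤ) :
    affineForm B (affineRoot P i k) (affineRoot P i k) = B.form (P.root i) (P.root i) := by
  simp [affineForm_apply, affineRoot, incl, delta]

/-- The pairing `x ↦ 2 (α, x) / (α, α)` with the coroot of an affine real root `α`. -/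
def affineCorootForm (B : P.InvariantForm) (i : ι) (k : ℤ) : Module.Dual K (AffineSpan K V) :=
  (2 / affineForm B (affineRoot P i k) (affineRoot P i k)) • affineForm B (affineRoot P i k)

theorem affineCorootForm_self (B : P.InvariantForm) (i : ι) (k : ℤ) :
    affineCorootForm B i k (affineRoot P i k) = 2 := by
  have h : affineForm B (affineRoot P i k) (affineRoot P i k) ≠ 0 := by
    rw [affineForm_affineRoot_self]
    exact B.ne_zero i
  simp only [affineCorootForm, LinearMap.smul_apply, smul_eq_mul]
  exact div_mul_cancel₀ 2 h

/-- The reflection `x ↦ x - (2 (α, x) / (α, α)) α` in an affine real root `α`. -/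
def affineReflection (B : P.InvariantForm) (i : ι) (k : ℤ) :
    AffineSpan K V ≃ₗ[K] AffineSpan K V :=
  Module.reflection (affineCorootForm_self B i k)

/-- The affine Weyl group: the group generated by the reflections in all affine real roots. -/
def affineWeylGroup (B : P.InvariantForm) :
    Subgroup (AffineSpan K V ≃ₗ[K] AffineSpan K V) :=
  Subgroup.closure {s | ∃ (i : ι) (k : ℤ), affineReflection B i k = s}

/-- The set of positive affine roots that `w` sends to negative ones. -/
def inversionSet (b : P.Base) (w : AffineSpan K V ≃ₗ[K] AffineSpan K V) : Set (AffineSpan K V) :=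
  {α | α ∈ positiveAffineRoots b ∧ w α ∈ -positiveAffineRoots b}

/-- Admissible elements of the affine Weyl group. -/
structure IsAdmissible (B : P.InvariantForm) (b : P.Base)
    (w : AffineSpan K V ≃ₗ[K] AffineSpan K V) : Prop where
  mem_affineWeylGroup : w ∈ affineWeylGroup B
  simple_pos : ∀ i ∈ b.support, w (incl K (P.root i)) ∈ positiveAffineRoots b
  inv_simple : ∀ α ∈ affineSimpleRoots b, w⁻¹ α ∈ -positiveAffineRoots b →
    ∃ γ ∈ positiveRoots b, w⁻¹ α = incl K γ - delta K V

/-- The set `I_w = {γ ∈ Δ⁺ | δ - γ ∈ N̂(w)}`. -/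
def idealOf (b : P.Base) (w : AffineSpan K V ≃ₗ[K] AffineSpan K V) : Set V :=
  {γ | γ ∈ positiveRoots b ∧ delta K V - incl K γ ∈ inversionSet b w}

end Affine

end

end AdNilpotent

/-! Replace `δ - γ` by `x = γ - δ`: then `γ ∈ I_w` says that `w x` is positive. Condition (a) makes
`w` positive on all of `Δ⁺`, so `w (γ + ν - δ) = w (γ - δ) + w ν` gives the ideal property. If `w (γ
- δ)` is simple, no `γ - ν` lies in `I_w`: a root of affine height 1 is not a sum of two elements of
positive integral height.

The converse is the hard part. Let `negInv` be the set of negative real roots made positive by `w`;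
since `w` is positive on `Δ⁺`, all its members have level (coefficient of `δ`) at most -1.
`decomposes_aux` shows, by strong induction on the height of `w x`, that each `x ∈ negInv` with `w
x` not simple is `y + z`, where `y ∈ negInv` and `z` is in `negInv` or in `Δ⁺`. For `x = γ - δ`, of
level -1, `z` must be in `Δ⁺`, so `γ - z ∈ I_w` and `γ` is not a generator
(`exists_sub_of_notMem_simple`). Condition (b) enters the induction when `w y` is simple, forcing
`y` to have level -1.

Hence `γ ↦ w (γ - δ)` is a bijection from generators to the affine simple roots with negative
preimage, condition (b) giving surjectivity.

The induction runs in the axiomatic setting `AffineData`. The root system enters through a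
regrouping property of sums of three roots and through subtraction of affine simple roots, which
rests on the theory of the highest root. -/

namespace AdNilpotent

/-! ### Sums and differences of roots via a positive integral form. -/

section FiniteRoots

variable {ι K V N : Type*} [Finite ι] [Field K] [CharZero K] [AddCommGroup V] [Module K V]
  [AddCommGroup N] [Module K N] (P : RootPairing ι K V N) [P.IsCrystallographic]

/-- A finite crystallographic root pairing carries a positive integral invariant form, given here
by its values on roots. -/
theorem exists_rootInner : ∃ c : ι → ι → ℤ, (∀ i j, c i j = c j i) ∧ (∀ i, 0 < c i i) ∧
    (∀ i j, 0 < c i j ↔ 0 < P.pairingIn ℤ i j) ∧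
    (∀ (s : Finset ι) (f : ι → ℤ) (i j : ι), P.root i = ∑ k ∈ s, f k • P.root k →
      c i j = ∑ k ∈ s, f k * c k j) := by
  classical
  have : Fintype ι := Fintype.ofFinite ι
  let F := P.posRootForm ℤ
  refine ⟨fun i j ↦ F.posForm (P.rootSpanMem ℤ i) (P.rootSpanMem ℤ j), fun i j ↦ ?_, fun i ↦ ?_,
    fun i j ↦ ?_, fun s f i j h ↦ ?_⟩
  · simpa using F.isSymm_posForm.eq (P.rootSpanMem ℤ i) (P.rootSpanMem ℤ j)
  · exact F.zero_lt_posForm_apply_root i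
  · exact F.zero_lt_apply_root_root_iff i j
  · have h' : P.rootSpanMem ℤ i = ∑ k ∈ s, f k • P.rootSpanMem ℤ k := by
      apply Subtype.ext
      simpa using h
    beta_reduce
    rw [h', map_sum, LinearMap.sum_apply]
    simp only [map_zsmul, LinearMap.smul_apply, zsmul_eq_mul, Int.cast_id]

/-- The values on pairs of roots of a positive integral invariant form. -/
noncomputable def rootInner : ι → ι → ℤ := (exists_rootInner P).choose

theorem rootInner_comm (i j : ι) : rootInner P i j = rootInner P j i :=
  (exists_rootInner P).choose_spec.1 i j

theorem rootInner_self_pos (i : ι) : 0 < rootInner P i i :=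
  (exists_rootInner P).choose_spec.2.1 i

theorem rootInner_pos_iff (i j : ι) : 0 < rootInner P i j ↔ 0 < P.pairingIn ℤ i j :=
  (exists_rootInner P).choose_spec.2.2.1 i j

variable {P}

theorem rootInner_eq_sum {s : Finset ι} {f : ι → ℤ} {i : ι}
    (h : P.root i = ∑ k ∈ s, f k • P.root k) (j : ι) :
    rootInner P i j = ∑ k ∈ s, f k * rootInner P k j :=
  (exists_rootInner P).choose_spec.2.2.2 s f i j h

theorem rootInner_add {i j k : ι} (h : P.root k = P.root i + P.root j) (l : ι) :
    rootInner P k l = rootInner P i l + rootInner P j l := by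
  classical
  by_cases hij : i = j
  · subst hij
    have := rootInner_eq_sum (P := P) (s := {i}) (f := fun _ ↦ 2) (i := k) (by simp [h, two_smul]) l
    simpa [two_mul] using this
  · simpa [Finset.sum_pair hij] using rootInner_eq_sum (s := {i, j}) (f := fun _ ↦ 1) (i := k)
      (by simp [h, Finset.sum_pair hij]) l

theorem rootInner_neg {i k : ι} (h : P.root k = -P.root i) (l : ι) :
    rootInner P k l = -rootInner P i l := by
  simpa using rootInner_eq_sum (s := {i}) (f := fun _ ↦ -1) (i := k) (by simp [h]) l

omit [Finite ι] [CharZero K] in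
theorem exists_root_neg (P : RootPairing ι K V N) (i : ι) : ∃ j, P.root j = -P.root i :=
  ⟨P.reflectionPerm i i, by simp⟩

theorem exists_root_sub_of_rootInner_pos {i j : ι} (h : 0 < rootInner P i j) (hij : i ≠ j) :
    ∃ k, P.root k = P.root i - P.root j :=
  P.root_sub_root_mem_of_pairingIn_pos ((rootInner_pos_iff P i j).1 h) hij

theorem exists_root_add_of_rootInner_neg {i j : ι} (h : rootInner P i j < 0)
    (hij : P.root i ≠ -P.root j) : ∃ k, P.root k = P.root i + P.root j := by
  obtain ⟨j', hj'⟩ := exists_root_neg P j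
  have h1 : 0 < rootInner P i j' := by
    rw [rootInner_comm, rootInner_neg hj', rootInner_comm]; lia
  obtain ⟨k, hk⟩ := exists_root_sub_of_rootInner_pos h1 (by rintro rfl; exact hij hj')
  exact ⟨k, by rw [hk, hj', sub_neg_eq_add]⟩

/-- If `a`, `b`, `c`, `a + b` and `a + b + c` are roots, then one of `a + c`, `b + c` is a root or
zero. -/
theorem add_mem_of_add_add_mem {a b c s t : ι} (hs : P.root s = P.root a + P.root b)
    (ht : P.root t = P.root a + P.root b + P.root c) :
    (P.root a + P.root c = 0 ∨ ∃ k, P.root k = P.root a + P.root c) ∨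
      (P.root b + P.root c = 0 ∨ ∃ k, P.root k = P.root b + P.root c) := by
  -- Otherwise `c` has nonnegative product with `a` and `b`, while `t` has nonpositive product with
  -- both, because `t - b = a + c` and `t - a = b + c`. Then `(t, s) ≤ 0`, although `(t, s) = (s, s)
  -- + (c, s) > 0`.
  by_contra! hcon
  obtain ⟨⟨ha0, ha⟩, hb0, hb⟩ := hcon
  have hac : 0 ≤ rootInner P a c := by
    by_contra! h
    obtain ⟨k, hk⟩ := exists_root_add_of_rootInner_neg h
      (fun h ↦ ha0 (by rw [h, neg_add_cancel]))
    exact ha k hk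
  have hbc : 0 ≤ rootInner P b c := by
    by_contra! h
    obtain ⟨k, hk⟩ := exists_root_add_of_rootInner_neg h
      (fun h ↦ hb0 (by rw [h, neg_add_cancel]))
    exact hb k hk
  have htb : rootInner P t b ≤ 0 := by
    by_contra! h
    obtain ⟨k, hk⟩ := exists_root_sub_of_rootInner_pos h
      (by rintro rfl; exact ha0 (by simpa [add_right_comm] using ht))
    exact ha k (by rw [hk, ht]; abel)
  have hta : rootInner P t a ≤ 0 := by
    by_contra! h
    obtain ⟨k, hk⟩ := exists_root_sub_of_rootInner_pos h
      (by rintro rfl; exact hb0 (by simpa [add_assoc] using ht))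
    exact hb k (by rw [hk, ht]; abel)
  have h1 := rootInner_add (k := t) (i := s) (j := c) (by rw [ht, hs]) s
  have h2 := rootInner_add hs t
  have h3 := rootInner_add hs c
  have h4 := rootInner_self_pos P s
  rw [rootInner_comm P t a] at hta
  rw [rootInner_comm P t b] at htb
  rw [rootInner_comm P t s, rootInner_comm P c s] at h1
  lia

end FiniteRoots

/-! ### Existence, uniqueness and dominance of the highest root. -/

section HighestRoot

variable {ι K V N : Type*} [Finite ι] [Field K] [CharZero K] [AddCommGroup V] [Module K V]
  [AddCommGroup N] [Module K N] {P : RootPairing ι K V N} [P.IsCrystallographic] (b : P.Base)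

omit [Finite ι] [CharZero K] [P.IsCrystallographic] in
theorem sum_mem_closure_of_nonneg {f : ι → ℤ} (hf : ∀ j ∈ b.support, 0 ≤ f j) :
    ∑ j ∈ b.support, f j • P.root j ∈ AddSubmonoid.closure (P.root '' b.support) := by
  refine sum_mem fun j hj ↦ ?_
  obtain ⟨n, hn⟩ := Int.eq_ofNat_of_zero_le (hf j hj)
  rw [hn, natCast_zsmul]
  exact nsmul_mem (AddSubmonoid.subset_closure (Set.mem_image_of_mem _ hj)) n

variable {b}

omit [Finite ι] [P.IsCrystallographic] in
theorem exists_nonneg_sum_of_isPos {i : ι} (hi : b.IsPos i) :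
    ∃ f : ι → ℤ, (∀ j, 0 ≤ f j) ∧ P.root i = ∑ j ∈ b.support, f j • P.root j := by
  obtain ⟨f, hf₀, hf₁, hf₂⟩ := b.exists_root_eq_sum_int i
  refine ⟨f, ?_, hf₂⟩
  rcases hf₁ with h | h
  · exact fun j ↦ h.le j
  · rw [RootPairing.Base.isPos_iff, RootPairing.Base.height_eq_sum hf₂] at hi
    have := Finset.sum_nonpos (s := b.support) (f := f) fun j _ ↦ h.le j
    lia

omit [Finite ι] [P.IsCrystallographic] in
theorem root_mem_closure_of_isPos {i : ι} (hi : b.IsPos i) :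
    P.root i ∈ AddSubmonoid.closure (P.root '' b.support) := by
  obtain ⟨f, hf, h⟩ := exists_nonneg_sum_of_isPos hi
  rw [h]
  exact sum_mem_closure_of_nonneg b fun j _ ↦ hf j

variable (b)

omit [Finite ι] [P.IsCrystallographic] in
theorem height_neg {i j : ι} (h : P.root j = -P.root i) : b.height j = -b.height i := by
  have : j = P.reflectionPerm i i := P.root.injective (by simp [h])
  rw [this]
  exact b.height_reflectionPerm_self i

variable {b} in
/-- A positive root which is not simple remains a positive root after subtracting some simple
root. -/
theorem exists_simple_sub {i : ι} (hi : b.IsPos i) :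
    i ∈ b.support ∨ ∃ j ∈ b.support, ∃ k, b.IsPos k ∧ P.root k = P.root i - P.root j := by
  obtain ⟨j, hj, hj'⟩ := hi.exists_mem_support_pos_pairingIn
  rw [P.zero_lt_pairingIn_iff'] at hj'
  rcases eq_or_ne i j with rfl | hij
  · exact .inl hj
  obtain ⟨k, hk⟩ := P.root_sub_root_mem_of_pairingIn_pos hj' hij
  exact .inr ⟨j, hj, k, hi.sub hj hk, hk⟩

theorem rootInner_nonneg_of_height_maximal {t : ι} (ht : ∀ i, b.height i ≤ b.height t)
    (htpos : b.IsPos t) {i : ι} (hi : b.IsPos i) : 0 ≤ rootInner P t i := by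
  by_contra! h
  rw [RootPairing.Base.isPos_iff] at hi htpos
  obtain ⟨k, hk⟩ := exists_root_add_of_rootInner_neg h
    (fun h ↦ by have := height_neg b h; lia)
  have := b.height_add hk
  have := ht k
  lia

theorem rootInner_nonpos_of_ne {i j : ι} (hi : i ∈ b.support) (hj : j ∈ b.support) (h : i ≠ j) :
    rootInner P i j ≤ 0 := by
  have h1 := b.pairingIn_le_zero_of_ne h hi hj
  by_contra! h2
  have := (rootInner_pos_iff P i j).1 h2
  lia

/-- The form is tied to the pairing only through the sign condition `rootInner_pos_iff`; applying it
to `j` and to `-j` excludes both signs. -/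
theorem pairing_eq_zero_of_rootInner_eq_zero {i j : ι} (h : rootInner P i j = 0) :
    P.pairing i j = 0 := by
  obtain ⟨j', hj'⟩ := exists_root_neg P j
  have h1 : ¬ 0 < P.pairingIn ℤ i j := by rw [← rootInner_pos_iff]; lia
  have h2 : ¬ 0 < P.pairingIn ℤ j' i := by
    rw [← rootInner_pos_iff, rootInner_neg hj', rootInner_comm]; lia
  have h3 : P.pairingIn ℤ j' i = - P.pairingIn ℤ j i := by
    have : j' = P.reflectionPerm j j := P.root.injective (by simp [hj'])
    rw [this]; simp
  have h4 : ¬ P.pairingIn ℤ j i < 0 := by lia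
  have h5 : ¬ 0 < P.pairingIn ℤ j i := by rwa [P.zero_lt_pairingIn_iff']
  have h6 : P.pairingIn ℤ j i = 0 := by lia
  rw [P.pairing_eq_zero_iff', ← P.algebraMap_pairingIn ℤ, h6, map_zero]

/-- In an irreducible root system, a root of maximal height involves every simple root. -/
theorem coeff_pos_of_height_maximal [P.IsReduced] [P.IsIrreducible] {t : ι}
    (ht : ∀ i, b.height i ≤ b.height t) (htpos : b.IsPos t) {f : ι → ℤ} (hf : ∀ j, 0 ≤ f j)
    (hsum : P.root t = ∑ j ∈ b.support, f j • P.root j) : ∀ j ∈ b.support, 0 < f j := by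
  set S : Set ι := {j | j ∈ b.support ∧ 0 < f j} with hS
  have horth : ∀ j ∈ b.support, ¬ 0 < f j → ∀ i ∈ S, rootInner P i j = 0 := by
    intro j hj hfj i hi
    have h0 : f j = 0 := by have := hf j; lia
    have h1 := rootInner_nonneg_of_height_maximal b ht htpos (b.isPos_of_mem_support hj)
    rw [rootInner_eq_sum hsum] at h1
    -- The coefficient at `j` is zero and distinct simple roots have nonpositive products, so a
    -- nonnegative sum of these terms forces every term to vanish.
    have h2 : ∀ k ∈ b.support, f k * rootInner P k j ≤ 0 := by
      intro k hk
      rcases eq_or_ne k j with rfl | hkj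
      · simp [h0]
      · exact mul_nonpos_of_nonneg_of_nonpos (hf k) (rootInner_nonpos_of_ne b hk hj hkj)
    have h3 := (Finset.sum_eq_zero_iff_of_nonpos h2).1 (le_antisymm (Finset.sum_nonpos h2) h1)
      i hi.1
    exact (mul_eq_zero.1 h3).resolve_left hi.2.ne'
  have hne : S.Nonempty := by
    by_contra! h
    apply P.ne_zero t
    rw [hsum]
    refine Finset.sum_eq_zero fun j hj ↦ ?_
    have h1 : ¬ 0 < f j := fun h' ↦ by
      have : j ∈ S := ⟨hj, h'⟩
      simp [h] at this
    have : f j = 0 := by have := hf j; lia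
    simp [this]
  -- Reflections in simple roots of `S` preserve the span of `S`, and those outside `S` fix it by
  -- orthogonality. Irreducibility makes the span everything, so linear independence leaves no
  -- simple root outside `S`.
  have htop : Submodule.span K (P.root '' S) = ⊤ := by
    refine RootPairing.IsIrreducible.eq_top_of_invtSubmodule_reflection (P := P) _ ?_ ?_
    · rw [← b.forall_mem_support_invtSubmodule_iff]
      intro j hj
      by_cases hfj : 0 < f j
      · exact Submodule.mem_invtSubmodule_reflection_of_mem _ _
          (Submodule.subset_span ⟨j, ⟨hj, hfj⟩, rfl⟩)
      · rw [Module.End.mem_invtSubmodule, Submodule.span_le]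
        rintro _ ⟨i, hi, rfl⟩
        have h0 := pairing_eq_zero_of_rootInner_eq_zero (horth j hj hfj i hi)
        have : P.reflection j (P.root i) = P.root i := by
          rw [RootPairing.reflection_apply_root, h0, zero_smul, sub_zero]
        simp only [SetLike.mem_coe, Submodule.mem_comap, LinearEquiv.coe_coe, this]
        exact Submodule.subset_span ⟨i, hi, rfl⟩
    · obtain ⟨i, hi⟩ := hne
      intro h
      rw [Submodule.span_eq_bot] at h
      exact P.ne_zero i (h _ ⟨i, hi, rfl⟩)
  intro j hj
  by_contra hfj
  have hjS : j ∉ S := fun h ↦ hfj h.2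
  have hins : LinearIndepOn K P.root (insert j S) :=
    b.linearIndepOn_root.mono (Set.insert_subset hj fun i hi ↦ hi.1)
  exact ((linearIndepOn_insert hjS).1 hins).2 (htop ▸ Submodule.mem_top)

variable {b} in
/-- In an irreducible root system, a root `t` of maximal height minus any other dominant root is a
positive root. -/
theorem exists_root_sub_of_dominant [P.IsReduced] [P.IsIrreducible] {t : ι}
    (ht : ∀ i, b.height i ≤ b.height t) (htpos : b.IsPos t) {i : ι} (hit : i ≠ t)
    (hi : ∀ j ∈ b.support, 0 ≤ rootInner P i j) :
    ∃ k, b.IsPos k ∧ P.root k = P.root t - P.root i := by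
  obtain ⟨f, hf, hsum⟩ := exists_nonneg_sum_of_isPos htpos
  have hpos := coeff_pos_of_height_maximal b ht htpos hf hsum
  -- All coefficients of `t` are positive, so a zero product would make `i` orthogonal to every
  -- simple root, hence to itself.
  have hti : 0 < rootInner P t i := by
    rw [rootInner_eq_sum hsum]
    have hnn : ∀ j ∈ b.support, 0 ≤ f j * rootInner P j i := fun j hj ↦
      mul_nonneg (hf j) (rootInner_comm P i j ▸ hi j hj)
    refine lt_of_le_of_ne (Finset.sum_nonneg hnn) fun h ↦ ?_
    have h0 := (Finset.sum_eq_zero_iff_of_nonneg hnn).1 h.symm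
    obtain ⟨g, -, -, hg⟩ := b.exists_root_eq_sum_int i
    have h1 := rootInner_self_pos P i
    rw [rootInner_eq_sum hg, Finset.sum_eq_zero] at h1
    · exact lt_irrefl _ h1
    · intro j hj
      rw [(mul_eq_zero.1 (h0 j hj)).resolve_left (hpos j hj).ne', mul_zero]
  obtain ⟨k, hk⟩ := exists_root_sub_of_rootInner_pos hti hit.symm
  refine ⟨k, ?_, hk⟩
  rw [RootPairing.Base.isPos_iff', b.height_sub hk]
  have := ht i
  lia

omit [P.IsCrystallographic] in
theorem exists_isPos_height_maximal [Nonempty ι] :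
    ∃ t, b.IsPos t ∧ ∀ i, b.height i ≤ b.height t := by
  obtain ⟨t, ht⟩ := Finite.exists_max b.height
  refine ⟨t, ?_, ht⟩
  obtain ⟨j, hj⟩ := b.support_nonempty
  have h1 := ht j
  rw [b.height_one_of_mem_support hj] at h1
  rw [RootPairing.Base.isPos_iff]
  lia

/-- Climb from `i` by adding elements of `Q⁺`: a root `g` of maximal height reached this way is
dominant, so it is `t` or differs from `t` by a positive root. -/
theorem isHighestRoot_of_height_maximal [P.IsReduced] [P.IsIrreducible] {t : ι}
    (ht : ∀ i, b.height i ≤ b.height t) (htpos : b.IsPos t) : IsHighestRoot b (P.root t) := by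
  refine ⟨⟨t, rfl⟩, fun i ↦ ?_⟩
  set Q := AddSubmonoid.closure (P.root '' b.support)
  have : Nonempty {k // P.root k - P.root i ∈ Q} := ⟨i, by simp⟩
  obtain ⟨⟨g, hg⟩, hmax⟩ := Finite.exists_max fun k : {k // P.root k - P.root i ∈ Q} ↦ b.height k
  replace hmax : ∀ k, P.root k - P.root i ∈ Q → b.height k ≤ b.height g :=
    fun k hk ↦ hmax ⟨k, hk⟩
  by_cases hgt : g = t
  · exact hgt ▸ hg
  have hdom : ∀ j ∈ b.support, 0 ≤ rootInner P g j := by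
    intro j hj
    by_contra! h
    have hjQ : P.root j ∈ Q := AddSubmonoid.subset_closure (Set.mem_image_of_mem _ hj)
    have hj1 := b.height_one_of_mem_support hj
    -- Here adding the simple root once gives zero, which is not a root; adding it twice gives a
    -- higher root.
    by_cases hgj : P.root g = -P.root j
    · have h1 := hmax j (by
        have h2 : P.root j - P.root i = (P.root g - P.root i) + P.root j + P.root j := by
          rw [hgj]; abel
        rw [h2]
        exact add_mem (add_mem hg hjQ) hjQ)
      rw [height_neg b hgj] at h1
      lia
    · obtain ⟨k, hk⟩ := exists_root_add_of_rootInner_neg h hgj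
      have h1 := hmax k (by
        have h2 : P.root k - P.root i = (P.root g - P.root i) + P.root j := by
          rw [hk]; abel
        rw [h2]
        exact add_mem hg hjQ)
      rw [b.height_add hk] at h1
      lia
  obtain ⟨k, hkpos, hk⟩ := exists_root_sub_of_dominant ht htpos hgt hdom
  have h1 : P.root t - P.root i = P.root k + (P.root g - P.root i) := by rw [hk]; abel
  rw [h1]
  exact add_mem (root_mem_closure_of_isPos hkpos) hg

/-- The linear functional on `V` extending the height of roots. -/
noncomputable def heightFunctional [P.IsRootSystem] : V →ₗ[K] K :=
  b.toWeightBasis.constr K fun _ ↦ (1 : K)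

omit [Finite ι] [P.IsCrystallographic] in
theorem heightFunctional_root [P.IsRootSystem] (i : ι) :
    heightFunctional b (P.root i) = b.height i := by
  have h : ∀ j ∈ b.support, heightFunctional b (P.root j) = 1 := by
    intro j hj
    have := b.toWeightBasis.constr_basis K (fun _ ↦ (1 : K)) ⟨j, hj⟩
    simpa [heightFunctional] using this
  obtain ⟨f, -, -, hf⟩ := b.exists_root_eq_sum_int i
  rw [RootPairing.Base.height_eq_sum hf, hf, map_sum, Int.cast_sum]
  refine Finset.sum_congr rfl fun j hj ↦ ?_
  rw [map_zsmul, h j hj, zsmul_one]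

omit [Finite ι] [P.IsCrystallographic] in
theorem exists_heightFunctional_eq_natCast [P.IsRootSystem] {x : V}
    (hx : x ∈ AddSubmonoid.closure (P.root '' b.support)) :
    ∃ n : ℕ, heightFunctional b x = n := by
  induction hx using AddSubmonoid.closure_induction with
  | mem x hx =>
    obtain ⟨j, hj, rfl⟩ := hx
    exact ⟨1, by simp [heightFunctional_root, b.height_one_of_mem_support hj]⟩
  | zero => exact ⟨0, by simp⟩
  | add x y _ _ hx hy =>
    obtain ⟨m, hm⟩ := hx
    obtain ⟨n, hn⟩ := hy
    exact ⟨m + n, by simp [hm, hn]⟩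

/-- Two distinct roots of maximal height are both dominant, so their difference would be a positive
root of height zero. -/
theorem IsHighestRoot.eq_root [P.IsRootSystem] [P.IsReduced] [P.IsIrreducible] {t : ι}
    (ht : ∀ i, b.height i ≤ b.height t) (htpos : b.IsPos t) {θ : V} (hθ : IsHighestRoot b θ) :
    θ = P.root t := by
  obtain ⟨⟨s, rfl⟩, hs⟩ := hθ
  obtain ⟨n, hn⟩ := exists_heightFunctional_eq_natCast b (hs t)
  rw [map_sub, heightFunctional_root, heightFunctional_root] at hn
  have hst : b.height s - b.height t = n := by exact_mod_cast hn
  have hts := ht s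
  have hmax : ∀ i, b.height i ≤ b.height s := fun i ↦ by have := ht i; lia
  have hspos : b.IsPos s := by rw [RootPairing.Base.isPos_iff] at htpos ⊢; lia
  by_contra hne
  obtain ⟨k, hkpos, hk⟩ := exists_root_sub_of_dominant ht htpos (i := s)
    (fun h ↦ hne (by rw [h])) fun j hj ↦
      rootInner_nonneg_of_height_maximal b hmax hspos (b.isPos_of_mem_support hj)
  have := b.height_sub hk
  rw [RootPairing.Base.isPos_iff] at hkpos
  lia

variable {b} in
/-- A positive root other than the highest root `t` remains a root after adding some simple root,
or its difference to `t` is a positive root. -/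
theorem exists_simple_add [P.IsReduced] [P.IsIrreducible] {t : ι}
    (ht : ∀ i, b.height i ≤ b.height t) (htpos : b.IsPos t) {i : ι} (hi : b.IsPos i)
    (hit : i ≠ t) : (∃ j ∈ b.support, ∃ k, P.root k = P.root i + P.root j) ∨
      ∃ k, b.IsPos k ∧ P.root k = P.root t - P.root i := by
  by_cases hdom : ∀ j ∈ b.support, 0 ≤ rootInner P i j
  · exact .inr (exists_root_sub_of_dominant ht htpos hit hdom)
  push Not at hdom
  obtain ⟨j, hj, h⟩ := hdom
  refine .inl ⟨j, hj, exists_root_add_of_rootInner_neg h fun h' ↦ ?_⟩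
  have := height_neg b h'
  rw [b.height_one_of_mem_support hj] at this
  rw [RootPairing.Base.isPos_iff] at hi
  lia

end HighestRoot


/-! ### Axiomatic affine roots and the decomposition of negative roots made positive. -/

/-- The combinatorial properties of a set `R` of affine real roots, with imaginary roots the
multiples of `δ`, finite positive roots `D`, simple roots `S`, height `ht` and level `lev`, on which
the description of generators depends. -/
structure AffineData (K M : Type*) [Field K] [AddCommGroup M] where
  ht : M →+ K
  lev : M →+ K
  δ : M
  R : Set M
  D : Set M
  S : Set M
  neg_mem : ∀ x ∈ R, -x ∈ R
  pos_or_neg : ∀ x ∈ R, (∃ n : ℕ, 0 < n ∧ ht x = n) ∨ ∃ n : ℕ, 0 < n ∧ ht (-x) = n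
  ht_delta : ∃ n : ℕ, 0 < n ∧ ht δ = n
  lev_delta : lev δ = 1
  lev_of_pos : ∀ x ∈ R, (∃ n : ℕ, 0 < n ∧ ht x = n) → x ∈ D ∨ ∃ m : ℕ, 0 < m ∧ lev x = m
  finite_pos : ∀ x ∈ D, x ∈ R ∧ (∃ n : ℕ, 0 < n ∧ ht x = n) ∧ lev x = 0
  add_zsmul_mem : ∀ x ∈ R, ∀ m : ℤ, x + m • δ ∈ R
  add_mem_of_add_add_mem : ∀ u ∈ R, ∀ v ∈ R, ∀ p ∈ R, u + v ∈ R → u + v + p ∈ R →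
    (u + p ∈ R ∨ ∃ m : ℤ, u + p = m • δ) ∨ (v + p ∈ R ∨ ∃ m : ℤ, v + p = m • δ)
  simple : ∀ x ∈ S, x ∈ R ∧ ht x = 1
  exists_sub : ∀ x ∈ R, (∃ n : ℕ, 0 < n ∧ ht x = n) → x ∈ S ∨ ∃ α ∈ S,
    (x - α ∈ R ∧ ∃ n : ℕ, 0 < n ∧ ht (x - α) = n) ∨ ∃ m : ℕ, 0 < m ∧ x - α = m • δ

namespace AffineData

variable {K M : Type*} [Field K] [AddCommGroup M] (A : AffineData K M)

/-- Elements of positive integral height. -/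
def Pos (x : M) : Prop := ∃ n : ℕ, 0 < n ∧ A.ht x = n

variable {A}

theorem Pos.add {x y : M} (hx : A.Pos x) (hy : A.Pos y) : A.Pos (x + y) := by
  obtain ⟨m, hm, hm'⟩ := hx
  obtain ⟨n, hn, hn'⟩ := hy
  exact ⟨m + n, by lia, by simp [hm', hn']⟩

theorem Pos.nsmul_delta {m : ℕ} (hm : 0 < m) : A.Pos (m • A.δ) := by
  obtain ⟨n, hn, hn'⟩ := A.ht_delta
  exact ⟨m * n, by positivity, by simp [hn']⟩

theorem pos_of_mem_simple {x : M} (hx : x ∈ A.S) : A.Pos x :=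
  ⟨1, one_pos, by simp [(A.simple x hx).2]⟩

section CharZero

variable [CharZero K]

theorem Pos.not_zero {x : M} (hx : A.Pos x) : x ≠ 0 := by
  rintro rfl
  obtain ⟨m, hm, hm'⟩ := hx
  rw [map_zero, eq_comm, Nat.cast_eq_zero] at hm'
  lia

theorem Pos.not_neg {x : M} (hx : A.Pos x) : ¬ A.Pos (-x) := fun h ↦
  (hx.add h).not_zero (add_neg_cancel x)

theorem exists_nat_of_pos_zsmul_delta {m : ℤ} (h : A.Pos (m • A.δ)) :
    ∃ n : ℕ, 0 < n ∧ m = n := by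
  rcases lt_trichotomy m 0 with hm | rfl | hm
  · obtain ⟨n, hn⟩ := Int.eq_ofNat_of_zero_le (a := -m) (by lia)
    have h1 : A.Pos (-(m • A.δ)) := by
      rw [← neg_zsmul, hn, natCast_zsmul]
      exact Pos.nsmul_delta (by lia)
    exact absurd h1 h.not_neg
  · exact absurd (zero_zsmul _) h.not_zero
  · obtain ⟨n, hn⟩ := Int.eq_ofNat_of_zero_le hm.le
    exact ⟨n, by lia, hn⟩

/-- A simple root is not the sum of two elements of positive height. -/
theorem add_notMem_simple {x y : M} (hx : A.Pos x) (hy : A.Pos y) : x + y ∉ A.S := by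
  intro h
  have h1 := (A.simple _ h).2
  obtain ⟨m, hm, hm'⟩ := hx
  obtain ⟨n, hn, hn'⟩ := hy
  rw [map_add, hm', hn'] at h1
  have : m + n = 1 := by exact_mod_cast h1
  lia

end CharZero

/-- An additive automorphism `w` permuting the real roots, fixing `δ`, positive on finite positive
roots, and such that negative roots which `w` sends to simple roots have the form `γ - δ`. -/
structure IsAdmissible (A : AffineData K M) (w : M →+ M) : Prop where
  bijective : Function.Bijective w
  map_mem_iff : ∀ x, w x ∈ A.R ↔ x ∈ A.R
  map_delta : w A.δ = A.δ
  pos : ∀ x ∈ A.D, A.Pos (w x)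
  simple : ∀ x, w x ∈ A.S → A.Pos (-x) → ∃ γ ∈ A.D, x = γ - A.δ

/-- The negative real roots which `w` makes positive. -/
def negInv (A : AffineData K M) (w : M →+ M) : Set M :=
  {x | x ∈ A.R ∧ A.Pos (-x) ∧ A.Pos (w x)}

/-- `x` is a sum of an element of `negInv` and of an element of `negInv` or a finite positive
root. -/
def Decomposes (A : AffineData K M) (w : M →+ M) (x : M) : Prop :=
  ∃ y ∈ A.negInv w, ∃ z, (z ∈ A.negInv w ∨ z ∈ A.D) ∧ x = y + z

variable {w : M →+ M}

namespace IsAdmissible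

theorem map_nsmul_delta (hw : A.IsAdmissible w) (m : ℕ) : w (m • A.δ) = m • A.δ := by
  rw [map_nsmul, hw.map_delta]

theorem map_zsmul_delta (hw : A.IsAdmissible w) (m : ℤ) : w (m • A.δ) = m • A.δ := by
  rw [map_zsmul, hw.map_delta]

variable [CharZero K]

theorem lev_of_mem_negInv (hw : A.IsAdmissible w) {x : M} (hx : x ∈ A.negInv w) :
    ∃ m : ℕ, 0 < m ∧ A.lev x = -m := by
  obtain ⟨hxR, hx, hwx⟩ := hx
  rcases A.lev_of_pos _ (A.neg_mem x hxR) hx with h | ⟨m, hm, h⟩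
  · have := hw.pos _ h
    rw [map_neg] at this
    exact absurd this hwx.not_neg
  · exact ⟨m, hm, by rw [← h, map_neg, neg_neg]⟩

/-- If `y` and `y + p` are in `negInv`, `p` is positive and `w y` is simple, then `p` is a finite
positive root. -/
theorem mem_finite_of_simple (hw : A.IsAdmissible w) {y p : M} (hy : y ∈ A.negInv w)
    (hys : w y ∈ A.S) (hp : (p ∈ A.R ∧ A.Pos p) ∨ ∃ m : ℕ, 0 < m ∧ p = m • A.δ)
    (hyp : y + p ∈ A.negInv w) : p ∈ A.D := by
  obtain ⟨γ, hγ, hyγ⟩ := hw.simple y hys hy.2.1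
  obtain ⟨m, hm, hm'⟩ := hw.lev_of_mem_negInv hyp
  have hlevy : A.lev y = -1 := by rw [hyγ, map_sub, (A.finite_pos γ hγ).2.2, A.lev_delta, zero_sub]
  have hp' : p ∈ A.D ∨ ∃ m : ℕ, 0 < m ∧ A.lev p = m := by
    rcases hp with ⟨hpR, hp⟩ | ⟨m, hm, rfl⟩
    · exact A.lev_of_pos p hpR hp
    · exact .inr ⟨m, hm, by simp [A.lev_delta]⟩
  -- The level of `y` is -1, so a `p` of level at least 1 would lift `y + p` out of the negative
  -- levels.
  refine hp'.resolve_right ?_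
  rintro ⟨n, hn, hn'⟩
  rw [map_add, hlevy, hn'] at hm'
  have : (n : K) + m = 1 := by linear_combination hm'
  have : n + m = 1 := by exact_mod_cast this
  lia

/-- The main induction: every `x ∈ negInv` with `w x` not simple decomposes, and so does every
`y + p ∈ negInv` with `y ∈ negInv` and `p`, `w p` positive. -/
theorem decomposes_aux (hw : A.IsAdmissible w) (n : ℕ) :
    (∀ x ∈ A.negInv w, A.ht (w x) = n → w x ∈ A.S ∨ A.Decomposes w x) ∧
    ∀ y ∈ A.negInv w, A.ht (w y) = n → ∀ p,
      ((p ∈ A.R ∧ A.Pos p) ∨ ∃ m : ℕ, 0 < m ∧ p = m • A.δ) → A.Pos (w p) →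
      y + p ∈ A.negInv w → A.Decomposes w (y + p) := by
  induction n using Nat.strong_induction_on with
  | _ n ih =>
  -- Heights of images are positive integers and add up, so each summand has an image of smaller
  -- height and the induction applies to it.
  have hlt : ∀ {x z : M}, A.Pos (w x) → A.Pos (w z) → A.ht (w (x + z)) = n →
      ∃ k < n, A.ht (w x) = k := by
    rintro x z ⟨k, -, hk⟩ ⟨l, hl, hl'⟩ h
    rw [map_add, map_add, hk, hl'] at h
    have : k + l = n := by exact_mod_cast h
    exact ⟨k, by lia, hk⟩
  have first : ∀ x ∈ A.negInv w, A.ht (w x) = n → w x ∈ A.S ∨ A.Decomposes w x := by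
    intro x hx hxn
    rcases A.exists_sub (w x) ((hw.map_mem_iff x).2 hx.1) hx.2.2 with h | ⟨α, hα, h⟩
    · exact .inl h
    right
    obtain ⟨a, rfl⟩ := hw.bijective.2 α
    rw [← map_sub] at h
    have haR := (hw.map_mem_iff a).1 (A.simple _ hα).1
    have hwa := pos_of_mem_simple hα
    obtain ⟨p, rfl⟩ : ∃ p, x = a + p := ⟨x - a, (add_sub_cancel a x).symm⟩
    rw [add_sub_cancel_left] at h
    rcases h with ⟨hpR, hwp⟩ | ⟨m, hm, h⟩
    · rw [hw.map_mem_iff] at hpR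
      -- Two positive summands contradict `x` being negative, two negative ones are a decomposition,
      -- and mixed signs are the second claim for the negative summand.
      rcases A.pos_or_neg a haR with ha | ha <;> rcases A.pos_or_neg p hpR with hp | hp
      · exact absurd hx.2.1 (Pos.not_neg (Pos.add ha hp))
      · obtain ⟨k, hk, hpk⟩ := hlt hwp hwa (by rwa [add_comm])
        rw [add_comm] at hx ⊢
        exact (ih k hk).2 p ⟨hpR, hp, hwp⟩ hpk a (.inl ⟨haR, ha⟩) hwa hx
      · obtain ⟨k, hk, hak⟩ := hlt hwa hwp hxn
        exact (ih k hk).2 a ⟨haR, ha, hwa⟩ hak p (.inl ⟨hpR, hp⟩) hwp hx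
      · exact ⟨a, ⟨haR, ha, hwa⟩, p, .inl ⟨hpR, hp, hwp⟩, rfl⟩
    · have hwp : A.Pos (w p) := h ▸ Pos.nsmul_delta hm
      rw [← hw.map_nsmul_delta] at h
      obtain rfl := hw.bijective.1 h
      rcases A.pos_or_neg a haR with ha | ha
      · exact absurd hx.2.1 (Pos.not_neg (Pos.add ha (Pos.nsmul_delta hm)))
      · obtain ⟨k, hk, hak⟩ := hlt hwa hwp hxn
        exact (ih k hk).2 a ⟨haR, ha, hwa⟩ hak _ (.inr ⟨m, hm, rfl⟩) hwp hx
  refine ⟨first, fun y hy hyn p hp hwp hyp ↦ ?_⟩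
  -- If `w y` is not simple, write `y = u + v` and regroup `u + v + p` by absorbing `p` into `u` or
  -- `v`.
  rcases first y hy hyn with hs | ⟨u, hu, v, hv, rfl⟩
  · exact ⟨y, hy, p, .inr (hw.mem_finite_of_simple hy hs hp hyp), rfl⟩
  have hvR : v ∈ A.R := hv.elim (fun h ↦ h.1) fun h ↦ (A.finite_pos v h).1
  have hwv : A.Pos (w v) := hv.elim (fun h ↦ h.2.2) fun h ↦ hw.pos v h
  obtain ⟨k, hk, huk⟩ := hlt hu.2.2 hwv hyn
  obtain ⟨l, hl, hvl⟩ := hlt hwv hu.2.2 (by rwa [add_comm])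
  have key1 : v + p ∈ A.R → A.Decomposes w (u + v + p) := by
    intro h
    have hwvp : A.Pos (w (v + p)) := by rw [map_add]; exact hwv.add hwp
    rw [add_assoc] at hyp ⊢
    rcases A.pos_or_neg _ h with hpos | hneg
    · exact (ih k hk).2 u hu huk (v + p) (.inl ⟨h, hpos⟩) hwvp hyp
    · exact ⟨u, hu, v + p, .inl ⟨h, hneg, hwvp⟩, rfl⟩
  have key2 : (u + p ∈ A.R ∨ ∃ m : ℤ, u + p = m • A.δ) → A.Decomposes w (u + v + p) := by
    intro h
    have hwup : A.Pos (w (u + p)) := by rw [map_add]; exact hu.2.2.add hwp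
    have heq : u + v + p = v + (u + p) := by abel
    have hpos : ((u + p ∈ A.R ∧ A.Pos (u + p)) ∨ ∃ m : ℕ, 0 < m ∧ u + p = m • A.δ) →
        A.Decomposes w (u + v + p) := by
      intro h
      have hup : A.Pos (u + p) := by
        rcases h with h | ⟨m, hm, h⟩
        · exact h.2
        · rw [h]; exact Pos.nsmul_delta hm
      -- With `u + p` positive, `v` cannot also be positive since the total is negative; so the
      -- second claim applies to `v` in the role of `y`.
      have hvN : v ∈ A.negInv w := by
        refine hv.resolve_right fun hvD ↦ ?_
        have h1 := (A.finite_pos v hvD).2.1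
        have h2 : A.Pos (v + (u + p)) := Pos.add h1 hup
        rw [← heq] at h2
        exact h2.not_neg hyp.2.1
      rw [heq] at hyp ⊢
      exact (ih l hl).2 v hvN hvl (u + p) h hwup hyp
    rcases h with h | ⟨m, h⟩
    · rcases A.pos_or_neg _ h with hup | hneg
      · exact hpos (.inl ⟨h, hup⟩)
      · rw [heq, add_comm]
        exact ⟨u + p, ⟨h, hneg, hwup⟩, v, hv, rfl⟩
    · rw [h, hw.map_zsmul_delta] at hwup
      obtain ⟨n, hn, rfl⟩ := exists_nat_of_pos_zsmul_delta hwup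
      exact hpos (.inr ⟨n, hn, by rw [h, natCast_zsmul]⟩)
  rcases hp with ⟨hpR, hp⟩ | ⟨m, hm, rfl⟩
  · rcases A.add_mem_of_add_add_mem u hu.1 v hvR p hpR hy.1 hyp.1 with h | h | ⟨m, h⟩
    · exact key2 h
    · exact key1 h
    · have hwvp : A.Pos (w (v + p)) := by rw [map_add]; exact hwv.add hwp
      rw [h, hw.map_zsmul_delta] at hwvp
      obtain ⟨j, hj, rfl⟩ := exists_nat_of_pos_zsmul_delta hwvp
      have hwvp : A.Pos (w (v + p)) := by rw [map_add]; exact hwv.add hwp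
      rw [natCast_zsmul] at h
      rw [add_assoc] at hyp ⊢
      exact (ih k hk).2 u hu huk (v + p) (.inr ⟨j, hj, h⟩) hwvp hyp
  -- An imaginary `p` can always be absorbed: a real root shifted by a multiple of `δ` is again a
  -- real root.
  · apply key1
    have := A.add_zsmul_mem v hvR m
    rwa [natCast_zsmul] at this

theorem mem_simple_or_decomposes (hw : A.IsAdmissible w) {x : M} (hx : x ∈ A.negInv w) :
    w x ∈ A.S ∨ A.Decomposes w x := by
  obtain ⟨n, -, hn⟩ := hx.2.2
  exact (hw.decomposes_aux n).1 x hx hn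

/-- A finite positive root `γ` with `w (γ - δ)` positive but not simple exceeds another finite
positive root `g` with `w (g - δ)` positive by a finite positive root. -/
theorem exists_sub_of_notMem_simple (hw : A.IsAdmissible w) {γ : M} (hγ : γ ∈ A.D)
    (hγR : γ - A.δ ∈ A.negInv w) (hs : w (γ - A.δ) ∉ A.S) :
    ∃ ν ∈ A.D, γ - ν ∈ A.D ∧ A.Pos (w (γ - ν - A.δ)) := by
  obtain ⟨y, hy, z, hz, h⟩ := (hw.mem_simple_or_decomposes hγR).resolve_left hs
  have hlev : A.lev (γ - A.δ) = -1 := by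
    rw [map_sub, (A.finite_pos γ hγ).2.2, A.lev_delta, zero_sub]
  have hzD : z ∈ A.D := by
    refine hz.resolve_left fun hz ↦ ?_
    obtain ⟨m, hm, hm'⟩ := hw.lev_of_mem_negInv hy
    obtain ⟨n, hn, hn'⟩ := hw.lev_of_mem_negInv hz
    rw [h, map_add, hm', hn'] at hlev
    have : (m : K) + n = 1 := by linear_combination -hlev
    have : m + n = 1 := by exact_mod_cast this
    lia
  have hg : γ - z - A.δ = y := by
    rw [sub_right_comm, h, add_sub_cancel_right]
  have hgy : γ - z = y + (1 : ℤ) • A.δ := by rw [← hg, one_zsmul, sub_add_cancel]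
  have hgR : γ - z ∈ A.R := hgy ▸ A.add_zsmul_mem y hy.1 1
  have hglev : A.lev (γ - z) = 0 := by
    rw [map_sub, (A.finite_pos γ hγ).2.2, (A.finite_pos z hzD).2.2, sub_zero]
  refine ⟨z, hzD, ?_, by rw [hg]; exact hy.2.2⟩
  have hfin : ∀ x ∈ A.R, A.lev x = 0 → A.Pos x → x ∈ A.D := by
    intro x hx h0 hpos
    refine (A.lev_of_pos x hx hpos).resolve_right ?_
    rintro ⟨m, hm, h⟩
    rw [h0, eq_comm, Nat.cast_eq_zero] at h
    lia
  rcases A.pos_or_neg _ hgR with hpos | hneg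
  · exact hfin _ hgR hglev hpos
  -- If `γ - z` were negative, `z - γ` would be a finite positive root with positive image, making
  -- `-w y = w (z - γ) + δ` positive too.
  · have hD := hfin _ (A.neg_mem _ hgR) (by rw [map_neg, hglev, neg_zero]) hneg
    have h1 : A.Pos (-w y) := by
      have h2 : -w y = w (-(γ - z)) + A.δ := by
        rw [← hg, map_sub w (γ - z), hw.map_delta, map_neg]; abel
      rw [h2]
      exact (hw.pos _ hD).add A.ht_delta
    exact absurd h1 hy.2.2.not_neg

end IsAdmissible

end AffineData

open scoped Pointwise

theorem exists_nat_pos_intCast_iff {K : Type*} [Field K] [CharZero K] (z : ℤ) :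
    (∃ n : ℕ, 0 < n ∧ (z : K) = n) ↔ 0 < z := by
  constructor
  · rintro ⟨n, hn, h⟩
    have : z = n := by exact_mod_cast h
    lia
  · intro h
    obtain ⟨n, hn⟩ := Int.eq_ofNat_of_zero_le h.le
    exact ⟨n, by lia, by simp [hn]⟩

/-! ### Affine reflections, affine height and affine simple roots. -/

section AffineRoots

variable {ι K V N : Type*} [Field K] [CharZero K] [AddCommGroup V] [Module K V]
  [AddCommGroup N] [Module K N] {P : RootPairing ι K V N}

omit [CharZero K] in
theorem affineRoot_eq (i : ι) (k : ℤ) : affineRoot P i k = (P.root i, (k : K), 0) := by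
  simp [affineRoot, incl, delta]

section WeylGroup

theorem affineReflection_delta (B : P.InvariantForm) (i : ι) (k : ℤ) :
    affineReflection B i k (delta K V) = delta K V := by
  simp [affineReflection, Module.reflection_apply, affineCorootForm, affineForm_apply,
    affineRoot_eq, delta]

theorem affineReflection_affineRoot [P.IsCrystallographic] (B : P.InvariantForm) (i j : ι)
    (k l : ℤ) : affineReflection B i k (affineRoot P j l) =
      affineRoot P (P.reflectionPerm i j) (l - P.pairingIn ℤ j i * k) := by
  have h : affineCorootForm B i k (affineRoot P j l) = P.pairing j i := by
    have h1 := B.two_mul_apply_root_root j i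
    have h2 := B.ne_zero i
    have h3 : B.form (P.root i) (P.root j) = B.form (P.root j) (P.root i) := B.symm.eq _ _
    rw [affineCorootForm, affineForm_affineRoot_self]
    simp only [LinearMap.smul_apply, affineForm_apply, affineRoot_eq, smul_eq_mul]
    field_simp
    rw [h3]
    linear_combination h1
  rw [affineReflection, Module.reflection_apply, h, affineRoot_eq, affineRoot_eq, affineRoot_eq,
    RootPairing.root_reflectionPerm, RootPairing.reflection_apply_root,
    ← P.algebraMap_pairingIn ℤ j i]
  simp

theorem map_delta_of_mem_affineWeylGroup {B : P.InvariantForm}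
    {w : AffineSpan K V ≃ₗ[K] AffineSpan K V} (hw : w ∈ affineWeylGroup B) :
    w (delta K V) = delta K V := by
  induction hw using Subgroup.closure_induction with
  | mem x hx =>
    obtain ⟨i, k, rfl⟩ := hx
    exact affineReflection_delta B i k
  | one => rfl
  | mul x y _ _ hx hy => rw [LinearEquiv.mul_apply, hy, hx]
  | inv x _ hx => exact (LinearEquiv.symm_apply_eq x).2 hx.symm

theorem map_mem_affineRoots_iff [P.IsCrystallographic] {B : P.InvariantForm}
    {w : AffineSpan K V ≃ₗ[K] AffineSpan K V} (hw : w ∈ affineWeylGroup B) :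
    ∀ x, w x ∈ affineRoots P ↔ x ∈ affineRoots P := by
  induction hw using Subgroup.closure_induction with
  | mem x hx =>
    obtain ⟨i, k, rfl⟩ := hx
    have h : ∀ x ∈ affineRoots P, affineReflection B i k x ∈ affineRoots P := by
      rintro _ ⟨j, l, rfl⟩
      rw [affineReflection_affineRoot]
      exact ⟨_, _, rfl⟩
    refine fun x ↦ ⟨fun hx ↦ ?_, h x⟩
    have := h _ hx
    rwa [affineReflection, Module.involutive_reflection] at this
  | one => exact fun x ↦ Iff.rfl
  | mul x y _ _ hx hy => exact fun z ↦ by rw [LinearEquiv.mul_apply, hx, hy]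
  | inv x _ hx =>
    intro z
    rw [← hx]
    exact iff_of_eq (congrArg (· ∈ affineRoots P) (LinearEquiv.apply_symm_apply x z))

end WeylGroup

section Data

variable [Finite ι] [P.IsRootSystem] [P.IsCrystallographic] (b : P.Base)

/-- The height functional on `V ⊕ K δ ⊕ K λ` for which all affine simple roots have height one,
where `t` is the index of the highest root. -/
noncomputable def affineHeight (t : ι) : AffineSpan K V →+ K where
  toFun x := heightFunctional b x.1 + x.2.1 * (b.height t + 1)
  map_zero' := by simp
  map_add' x y := by simp; ring

omit [Finite ι] [P.IsCrystallographic] in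
theorem affineHeight_affineRoot (t i : ι) (k : ℤ) :
    affineHeight b t (affineRoot P i k) = ((b.height i + k * (b.height t + 1) : ℤ) : K) := by
  simp [affineHeight, affineRoot_eq, heightFunctional_root]

variable {b}

/-- Finite heights are bounded in absolute value by `b.height t`, less than the height `b.height t +
1` of `δ`, so any nonzero `k` decides the sign. -/
theorem affineHeight_pos_iff {t : ι} (ht : ∀ i, b.height i ≤ b.height t) (i : ι) (k : ℤ) :
    (∃ n : ℕ, 0 < n ∧ affineHeight b t (affineRoot P i k) = n) ↔
      1 ≤ k ∨ k = 0 ∧ b.IsPos i := by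
  rw [affineHeight_affineRoot, exists_nat_pos_intCast_iff, RootPairing.Base.isPos_iff]
  obtain ⟨j, hj⟩ := exists_root_neg P i
  have h1 := ht i
  have h2 := ht j
  rw [height_neg b hj] at h2
  rcases lt_trichotomy k 0 with hk | rfl | hk
  · constructor
    · intro h; nlinarith
    · intro h; lia
  · simp
  · constructor
    · intro h; exact .inl hk
    · intro _; nlinarith

omit [Finite ι] [P.IsRootSystem] [P.IsCrystallographic] [CharZero K] in
theorem neg_affineRoot_eq {i j : ι} (h : P.root j = -P.root i) (k : ℤ) :
    -affineRoot P i k = affineRoot P j (-k) := by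
  simp [affineRoot_eq, h]

theorem affineHeight_pos_or_neg {t : ι} (ht : ∀ i, b.height i ≤ b.height t)
    {x : AffineSpan K V} (hx : x ∈ affineRoots P) :
    (∃ n : ℕ, 0 < n ∧ affineHeight b t x = n) ∨ ∃ n : ℕ, 0 < n ∧ affineHeight b t (-x) = n := by
  obtain ⟨i, k, rfl⟩ := hx
  obtain ⟨j, hj⟩ := exists_root_neg P i
  rw [neg_affineRoot_eq hj, affineHeight_pos_iff ht, affineHeight_pos_iff ht,
    RootPairing.Base.isPos_iff, RootPairing.Base.isPos_iff, height_neg b hj]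
  have := b.height_ne_zero i
  lia

theorem mem_positiveAffineRoots_iff {t : ι} (ht : ∀ i, b.height i ≤ b.height t)
    {x : AffineSpan K V} : x ∈ positiveAffineRoots b ↔
      x ∈ affineRoots P ∧ ∃ n : ℕ, 0 < n ∧ affineHeight b t x = n := by
  constructor
  · rintro (⟨i, hi, rfl⟩ | ⟨i, k, hk, rfl⟩)
    · exact ⟨⟨i, 0, rfl⟩, (affineHeight_pos_iff ht i 0).2 (.inr ⟨rfl, hi⟩)⟩
    · exact ⟨⟨i, k, rfl⟩, (affineHeight_pos_iff ht i k).2 (.inl hk)⟩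
  · rintro ⟨⟨i, k, rfl⟩, h⟩
    rcases (affineHeight_pos_iff ht i k).1 h with hk | ⟨rfl, hi⟩
    · exact .inr ⟨i, k, hk, rfl⟩
    · exact .inl ⟨i, hi, rfl⟩

omit [P.IsRootSystem] in
theorem affineRoots_add_mem {u v p : AffineSpan K V} (hu : u ∈ affineRoots P)
    (hv : v ∈ affineRoots P) (hp : p ∈ affineRoots P) (huv : u + v ∈ affineRoots P)
    (huvp : u + v + p ∈ affineRoots P) :
    (u + p ∈ affineRoots P ∨ ∃ m : ℤ, u + p = m • delta K V) ∨
      (v + p ∈ affineRoots P ∨ ∃ m : ℤ, v + p = m • delta K V) := by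
  obtain ⟨i, k, rfl⟩ := hu
  obtain ⟨j, l, rfl⟩ := hv
  obtain ⟨c, m, rfl⟩ := hp
  obtain ⟨s, n, hs⟩ := huv
  obtain ⟨r, q, hr⟩ := huvp
  have aux : ∀ (i : ι) (k : ℤ), (P.root i + P.root c = 0 ∨
      ∃ k, P.root k = P.root i + P.root c) →
      affineRoot P i k + affineRoot P c m ∈ affineRoots P ∨
        ∃ n : ℤ, affineRoot P i k + affineRoot P c m = n • delta K V := by
    rintro i k (h | ⟨d, hd⟩)
    · exact .inr ⟨k + m, by simp [affineRoot_eq, delta, h]⟩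
    · exact .inl ⟨d, k + m, by simp [affineRoot_eq, hd]⟩
  simp only [affineRoot_eq, Prod.mk_add_mk] at hs hr
  exact (add_mem_of_add_add_mem (Prod.ext_iff.1 hs).1 (Prod.ext_iff.1 hr).1).imp
    (aux i k) (aux j l)

variable [P.IsReduced] [P.IsIrreducible]

omit [P.IsRootSystem] in
theorem delta_sub_mem_affineSimpleRoots {t : ι} (ht : ∀ i, b.height i ≤ b.height t)
    (htpos : b.IsPos t) : delta K V - incl K (P.root t) ∈ affineSimpleRoots b :=
  .inr ⟨_, isHighestRoot_of_height_maximal b ht htpos, rfl⟩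

theorem mem_affineSimpleRoots_iff {t : ι} (ht : ∀ i, b.height i ≤ b.height t)
    (htpos : b.IsPos t) {x : AffineSpan K V} : x ∈ affineSimpleRoots b ↔
      (∃ i ∈ b.support, affineRoot P i 0 = x) ∨ delta K V - incl K (P.root t) = x := by
  constructor
  · rintro (h | ⟨θ, hθ, rfl⟩)
    · exact .inl h
    · exact .inr (by rw [hθ.eq_root b ht htpos])
  · rintro (h | rfl)
    · exact .inl h
    · exact delta_sub_mem_affineSimpleRoots ht htpos

omit [Finite ι] [P.IsRootSystem] [P.IsCrystallographic] [P.IsReduced] [P.IsIrreducible] [CharZero K] in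
theorem delta_sub_incl_eq {i j : ι} (h : P.root j = -P.root i) :
    delta K V - incl K (P.root i) = affineRoot P j 1 := by
  simp [affineRoot_eq, delta, incl, h]

theorem affineSimpleRoots_height {t : ι} (ht : ∀ i, b.height i ≤ b.height t)
    (htpos : b.IsPos t) {x : AffineSpan K V} (hx : x ∈ affineSimpleRoots b) :
    x ∈ affineRoots P ∧ affineHeight b t x = 1 := by
  rcases (mem_affineSimpleRoots_iff ht htpos).1 hx with ⟨i, hi, rfl⟩ | rfl
  · exact ⟨⟨i, 0, rfl⟩, by simp [affineHeight_affineRoot, b.height_one_of_mem_support hi]⟩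
  · obtain ⟨j, hj⟩ := exists_root_neg P t
    rw [delta_sub_incl_eq hj]
    exact ⟨⟨j, 1, rfl⟩, by simp [affineHeight_affineRoot, height_neg b hj]⟩

/-- A positive affine root is simple, or becomes a positive real or imaginary root after subtracting
some simple root. -/
theorem exists_affineSimpleRoot_sub {t : ι} (ht : ∀ i, b.height i ≤ b.height t)
    (htpos : b.IsPos t) {x : AffineSpan K V} (hx : x ∈ affineRoots P)
    (hpos : ∃ n : ℕ, 0 < n ∧ affineHeight b t x = n) :
    x ∈ affineSimpleRoots b ∨ ∃ α ∈ affineSimpleRoots b,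
      (x - α ∈ affineRoots P ∧ ∃ n : ℕ, 0 < n ∧ affineHeight b t (x - α) = n) ∨
        ∃ m : ℕ, 0 < m ∧ x - α = m • delta K V := by
  obtain ⟨i, k, rfl⟩ := hx
  have hsimple : ∀ j ∈ b.support, affineRoot P j 0 ∈ affineSimpleRoots b :=
    fun j hj ↦ .inl ⟨j, hj, rfl⟩
  have hsub : ∀ {j l : ι} {m n : ℤ} {α : AffineSpan K V}, affineRoot P j m - α = affineRoot P l n →
      (1 ≤ n ∨ n = 0 ∧ b.IsPos l) → affineRoot P j m - α ∈ affineRoots P ∧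
        ∃ n : ℕ, 0 < n ∧ affineHeight b t (affineRoot P j m - α) = n := by
    intro j l m n α h hn
    rw [h, affineHeight_pos_iff ht]
    exact ⟨⟨l, n, rfl⟩, hn⟩
  rcases (affineHeight_pos_iff ht i k).1 hpos with hk | ⟨rfl, hi⟩
  · by_cases hi : b.IsPos i
    · rcases exists_simple_sub hi with hj | ⟨j, hj, l, -, hl⟩
      · refine .inr ⟨_, hsimple i hj, .inr ⟨k.toNat, by lia, ?_⟩⟩
        rw [← natCast_zsmul, Int.toNat_of_nonneg (by lia)]
        simp [affineRoot_eq, delta]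
      · exact .inr ⟨_, hsimple j hj, .inl (hsub (l := l) (n := k)
          (by simp [affineRoot_eq, hl]) (.inl hk))⟩
    · obtain ⟨j, hj⟩ := exists_root_neg P i
      have hjpos : b.IsPos j := by
        rw [RootPairing.Base.isPos_iff] at hi ⊢
        rw [height_neg b hj]
        have := b.height_ne_zero i
        lia
      have hij : P.root i = -P.root j := by rw [hj, neg_neg]
      by_cases hjt : j = t
      · subst hjt
        rcases hk.eq_or_lt with rfl | hk
        · left
          rw [← delta_sub_incl_eq hij]
          exact delta_sub_mem_affineSimpleRoots ht htpos
        · refine .inr ⟨_, delta_sub_mem_affineSimpleRoots ht htpos, .inr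
            ⟨(k - 1).toNat, by lia, ?_⟩⟩
          rw [← natCast_zsmul, Int.toNat_of_nonneg (by lia)]
          simp [affineRoot_eq, delta, incl, hij]
      -- The finite part is `-j`. If `j + s` is a root, subtract `s`; otherwise subtract `δ - θ`,
      -- leaving `(θ - j) + (k - 1)δ`, which is positive even for `k = 1`.
      · rcases exists_simple_add ht htpos hjpos hjt with ⟨s, hs, l, hl⟩ | ⟨l, hl, hl'⟩
        · obtain ⟨l', hl'⟩ := exists_root_neg P l
          exact .inr ⟨_, hsimple s hs, .inl (hsub (l := l') (n := k)
            (by simp [affineRoot_eq, hl', hl, hij, sub_eq_add_neg, add_comm]) (.inl hk))⟩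
        · refine .inr ⟨_, delta_sub_mem_affineSimpleRoots ht htpos, .inl (hsub (l := l)
            (n := k - 1) ?_ ?_)⟩
          · simp [affineRoot_eq, delta, incl, hl', hij, sub_eq_add_neg, add_comm]
          · rcases hk.eq_or_lt with rfl | hk
            · exact .inr ⟨by simp, hl⟩
            · exact .inl (by lia)
  · rcases exists_simple_sub hi with hj | ⟨j, hj, l, hlpos, hl⟩
    · exact .inl (hsimple i hj)
    · exact .inr ⟨_, hsimple j hj, .inl (hsub (l := l) (n := 0)
        (by simp [affineRoot_eq, hl]; rfl) (.inr ⟨rfl, hlpos⟩))⟩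

variable (b)

/-- The affine data of an irreducible root system with base `b` and highest root of index `t`. -/
noncomputable def affineData {t : ι} (ht : ∀ i, b.height i ≤ b.height t) (htpos : b.IsPos t) :
    AffineData K (AffineSpan K V) where
  ht := affineHeight b t
  lev := ((LinearMap.fst K K K).comp (LinearMap.snd K V (K × K))).toAddMonoidHom
  δ := delta K V
  R := affineRoots P
  D := incl K '' positiveRoots b
  S := affineSimpleRoots b
  neg_mem := by
    rintro _ ⟨i, k, rfl⟩
    obtain ⟨j, hj⟩ := exists_root_neg P i
    exact ⟨j, -k, (neg_affineRoot_eq hj k).symm⟩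
  pos_or_neg x hx := affineHeight_pos_or_neg ht hx
  ht_delta := by
    rw [RootPairing.Base.isPos_iff] at htpos
    have h : affineHeight b t (delta K V) = ((b.height t + 1 : ℤ) : K) := by
      simp [affineHeight, delta]
    rw [h, exists_nat_pos_intCast_iff]
    lia
  lev_delta := by simp [delta]
  lev_of_pos := by
    rintro _ ⟨i, k, rfl⟩ h
    rcases (affineHeight_pos_iff ht i k).1 h with hk | ⟨rfl, hi⟩
    · refine .inr ⟨k.toNat, by lia, ?_⟩
      rw [← Int.cast_natCast, Int.toNat_of_nonneg (by lia)]
      simp [affineRoot_eq]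
    · exact .inl ⟨_, ⟨i, hi, rfl⟩, by simp [affineRoot_eq, incl]⟩
  finite_pos := by
    rintro _ ⟨_, ⟨i, hi, rfl⟩, rfl⟩
    have h : incl K (P.root i) = affineRoot P i 0 := by simp [affineRoot_eq, incl]
    rw [h]
    exact ⟨⟨i, 0, rfl⟩, (affineHeight_pos_iff ht i 0).2 (.inr ⟨rfl, hi⟩), by simp [affineRoot_eq]⟩
  add_zsmul_mem := by
    rintro _ ⟨i, k, rfl⟩ m
    exact ⟨i, k + m, by simp [affineRoot_eq, delta]⟩
  add_mem_of_add_add_mem u hu v hv p hp := affineRoots_add_mem hu hv hp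
  simple x hx := affineSimpleRoots_height ht htpos hx
  exists_sub x hx := exists_affineSimpleRoot_sub ht htpos hx

end Data

end AffineRoots

/-! ### Ideals and generators attached to admissible elements. -/

section Admissible

variable {ι K V N : Type*} [Finite ι] [Field K] [CharZero K] [AddCommGroup V] [Module K V]
  [AddCommGroup N] [Module K N] {P : RootPairing ι K V N} [P.IsRootSystem] [P.IsCrystallographic]
  [P.IsReduced] [P.IsIrreducible] {b : P.Base} {B : P.InvariantForm}
  {w : AffineSpan K V ≃ₗ[K] AffineSpan K V}

omit [Finite ι] [P.IsRootSystem] [P.IsCrystallographic] [P.IsReduced] [P.IsIrreducible] in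
theorem exists_affineRoot_eq_incl_sub_delta {γ : V} (hγ : γ ∈ positiveRoots b) :
    ∃ i, affineRoot P i (-1) = incl K γ - delta K V := by
  obtain ⟨i, -, rfl⟩ := hγ
  exact ⟨i, by simp [affineRoot_eq, delta, incl]⟩

omit [CharZero K] [Module K V] in
theorem incl_add (x y : V) : incl K (x + y) = incl K x + incl K y := by simp [incl]

omit [CharZero K] [Module K V] in
theorem incl_sub (x y : V) : incl K (x - y) = incl K x - incl K y := by simp [incl]

omit [CharZero K] [AddCommGroup V] [Module K V] in
theorem incl_injective : Function.Injective (incl K : V → AffineSpan K V) :=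
  fun _ _ h ↦ congrArg Prod.fst h

section

variable {t : ι} (ht : ∀ i, b.height i ≤ b.height t) (htpos : b.IsPos t)

theorem mem_positiveAffineRoots_iff_pos {x : AffineSpan K V} :
    x ∈ positiveAffineRoots b ↔ x ∈ affineRoots P ∧ (affineData b ht htpos).Pos x :=
  mem_positiveAffineRoots_iff ht

theorem IsAdmissible.affineData_isAdmissible (hw : IsAdmissible B b w) :
    (affineData b ht htpos).IsAdmissible w.toLinearMap.toAddMonoidHom where
  bijective := w.bijective
  map_mem_iff := map_mem_affineRoots_iff hw.mem_affineWeylGroup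
  map_delta := map_delta_of_mem_affineWeylGroup hw.mem_affineWeylGroup
  pos := by
    rintro _ ⟨_, ⟨i, hi, rfl⟩, rfl⟩
    have hsimple : ∀ i ∈ b.support, (affineData b ht htpos).Pos (w (incl K (P.root i))) :=
      fun i hi ↦ ((mem_positiveAffineRoots_iff_pos ht htpos).1 (hw.simple_pos i hi)).2
    refine hi.induction_on_add (p := fun i ↦ (affineData b ht htpos).Pos (w (incl K (P.root i))))
      hsimple fun i j k hk hi hj ↦ ?_
    rw [hk, incl_add, map_add]
    exact hi.add (hsimple j hj)
  simple := by
    intro x hx hneg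
    have hxR : x ∈ affineRoots P := (map_mem_affineRoots_iff hw.mem_affineWeylGroup x).1
      ((affineData b ht htpos).simple _ hx).1
    have hinv : w⁻¹ (w x) = x := LinearEquiv.symm_apply_apply w x
    obtain ⟨γ, hγ, h⟩ := hw.inv_simple (w x) hx (by
      rw [hinv, Set.mem_neg, mem_positiveAffineRoots_iff_pos ht htpos]
      exact ⟨(affineData b ht htpos).neg_mem x hxR, hneg⟩)
    exact ⟨_, ⟨γ, hγ, rfl⟩, by rw [← hinv, h]; rfl⟩

theorem incl_sub_delta_mem_negInv_iff {γ : V}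
    (hγ : γ ∈ positiveRoots b) :
    incl K γ - delta K V ∈ (affineData b ht htpos).negInv w.toLinearMap.toAddMonoidHom ↔
      (affineData b ht htpos).Pos (w (incl K γ - delta K V)) := by
  refine ⟨fun h ↦ h.2.2, fun h ↦ ?_⟩
  obtain ⟨i, hi⟩ := exists_affineRoot_eq_incl_sub_delta hγ
  obtain ⟨j, hj⟩ := exists_root_neg P i
  refine ⟨⟨i, -1, hi⟩, ?_, h⟩
  rw [← hi, neg_affineRoot_eq hj, neg_neg]
  exact (affineHeight_pos_iff ht j 1).2 (.inl le_rfl)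

theorem IsAdmissible.mem_idealOf_iff (hw : IsAdmissible B b w) {γ : V} :
    γ ∈ idealOf b w ↔ γ ∈ positiveRoots b ∧
      (affineData b ht htpos).Pos (w (incl K γ - delta K V)) := by
  refine and_congr_right fun hγ ↦ ?_
  rw [← neg_sub (incl K γ), inversionSet, Set.mem_ofPred_eq, Set.mem_neg, map_neg, neg_neg,
    mem_positiveAffineRoots_iff_pos ht htpos, mem_positiveAffineRoots_iff_pos ht htpos]
  refine ⟨fun h ↦ h.2.2, fun h ↦ ?_⟩
  obtain ⟨hR, hneg, -⟩ := (incl_sub_delta_mem_negInv_iff ht htpos hγ).2 h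
  exact ⟨⟨(affineData b ht htpos).neg_mem _ hR, hneg⟩,
    (map_mem_affineRoots_iff hw.mem_affineWeylGroup _).2 hR, h⟩

include ht htpos

theorem IsAdmissible.isIdeal_idealOf (hw : IsAdmissible B b w) : IsIdeal b (idealOf b w) := by
  refine ⟨fun γ hγ ↦ hγ.1, ?_⟩
  rintro γ hγ ν hν ⟨k, hk⟩
  have hw' := hw.affineData_isAdmissible ht htpos
  rw [hw.mem_idealOf_iff ht htpos] at hγ ⊢
  obtain ⟨⟨i, hi, rfl⟩, hγ⟩ := hγ
  have hwν := hw'.pos _ ⟨ν, hν, rfl⟩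
  obtain ⟨j, hj, rfl⟩ := hν
  refine ⟨⟨k, hi.add hj hk, hk⟩, ?_⟩
  rw [incl_add, add_sub_right_comm, map_add]
  exact hγ.add hwν

theorem IsAdmissible.isGenerator_iff (hw : IsAdmissible B b w) {γ : V} (hγ : γ ∈ idealOf b w) :
    IsGenerator b (idealOf b w) γ ↔ w (delta K V - incl K γ) ∈ -affineSimpleRoots b := by
  have hw' := hw.affineData_isAdmissible ht htpos
  rw [Set.mem_neg, ← map_neg, neg_sub]
  constructor
  · rintro ⟨-, hgen⟩
    by_contra hs
    rw [hw.mem_idealOf_iff ht htpos] at hγ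
    obtain ⟨_, ⟨ν, hν, rfl⟩, ⟨g, hg, hgν⟩, hpos⟩ := hw'.exists_sub_of_notMem_simple
      ⟨γ, hγ.1, rfl⟩ ((incl_sub_delta_mem_negInv_iff ht htpos hγ.1).2 hγ.2) hs
    rw [← incl_sub] at hgν hpos
    obtain rfl := incl_injective hgν
    exact hgen ν hν ((hw.mem_idealOf_iff ht htpos).2 ⟨hg, hpos⟩)
  · refine fun hs ↦ ⟨hγ, fun ν hν h ↦ ?_⟩
    rw [hw.mem_idealOf_iff ht htpos] at h
    refine AffineData.add_notMem_simple (A := affineData b ht htpos) h.2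
      (hw'.pos _ ⟨ν, hν, rfl⟩) ?_
    have h1 : incl K γ - delta K V = (incl K (γ - ν) - delta K V) + incl K ν := by
      rw [incl_sub]; abel
    rw [h1, map_add] at hs
    exact hs

/-- Condition (b) says that a negative preimage of an affine simple root already has the form `γ -
δ`; positivity of the simple root puts `γ` in the ideal, and the criterion for generators does the
rest. -/
theorem IsAdmissible.image_generators (hw : IsAdmissible B b w) :
    (fun γ ↦ w (incl K γ - delta K V)) '' {γ : V | IsGenerator b (idealOf b w) γ} =
      {α | α ∈ affineSimpleRoots b ∧ w⁻¹ α ∈ -positiveAffineRoots b} := by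
  ext α
  constructor
  · rintro ⟨γ, hγ, rfl⟩
    have hs := (hw.isGenerator_iff ht htpos hγ.1).1 hγ
    rw [Set.mem_neg, ← map_neg, neg_sub] at hs
    refine ⟨hs, ?_⟩
    have hinv : w⁻¹ (w (incl K γ - delta K V)) = incl K γ - delta K V :=
      LinearEquiv.symm_apply_apply w _
    rw [hinv, Set.mem_neg, neg_sub]
    exact hγ.1.2.1
  · rintro ⟨hα, hneg⟩
    obtain ⟨γ, hγ, h⟩ := hw.inv_simple α hα hneg
    have hwα : w (incl K γ - delta K V) = α := by
      rw [← h]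
      exact LinearEquiv.apply_symm_apply w α
    have hγI : γ ∈ idealOf b w := by
      rw [hw.mem_idealOf_iff ht htpos, hwα]
      exact ⟨hγ, AffineData.pos_of_mem_simple (A := affineData b ht htpos) hα⟩
    refine ⟨γ, (hw.isGenerator_iff ht htpos hγI).2 ?_, hwα⟩
    rwa [Set.mem_neg, ← map_neg, neg_sub, hwα]

end

end Admissible

end AdNilpotent

open scoped Pointwise in
theorem theorem2p2 {ι K V N : Type*} [Finite ι] [Field K] [CharZero K]
    [AddCommGroup V] [Module K V] [AddCommGroup N] [Module K N]
    (P : RootPairing ι K V N) [P.IsRootSystem] [P.IsCrystallographic] [P.IsReduced]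
    [P.IsIrreducible] (b : P.Base) (B : P.InvariantForm)
    (w : AdNilpotent.AffineSpan K V ≃ₗ[K] AdNilpotent.AffineSpan K V)
    (hw : AdNilpotent.IsAdmissible B b w) :
    AdNilpotent.IsIdeal b (AdNilpotent.idealOf b w) ∧
    (∀ γ ∈ AdNilpotent.idealOf b w,
      (AdNilpotent.IsGenerator b (AdNilpotent.idealOf b w) γ ↔
        w (AdNilpotent.delta K V - AdNilpotent.incl K γ) ∈ -AdNilpotent.affineSimpleRoots b)) ∧
    {γ : V | AdNilpotent.IsGenerator b (AdNilpotent.idealOf b w) γ}.ncard =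
      {α | α ∈ AdNilpotent.affineSimpleRoots b ∧
        w⁻¹ α ∈ -AdNilpotent.positiveAffineRoots b}.ncard := by
  have : Nontrivial V := RootPairing.IsIrreducible.nontrivial P
  have : Nonempty ι := by
    by_contra h
    rw [not_nonempty_iff] at h
    have := RootPairing.IsRootSystem.span_root_eq_top (P := P)
    simp [Set.range_eq_empty] at this
  obtain ⟨t, htpos, ht⟩ := AdNilpotent.exists_isPos_height_maximal b
  refine ⟨hw.isIdeal_idealOf ht htpos, fun γ hγ ↦ hw.isGenerator_iff ht htpos hγ, ?_⟩
  rw [← hw.image_generators ht htpos, Set.ncard_image_of_injective]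
  exact fun x y h ↦ AdNilpotent.incl_injective (sub_left_injective (w.injective h))
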